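/- Consider $n\ge 2$ asynchronous, failure-free, anonymous processes $p_1,\dots,p_n$ that communicate through $m\ge 1$ anonymous atomic RMW registers $R[1],\dots,R[m]$. The processes have no identities: all of them run the same deterministic code (which may depend on $n$ and $m$) from the same initial local state. All registers hold the same initial value $\bot$. For each process $p_i$ an adversary fixes a permutation $f_i$ of $\{1,\dots,m\}$, unknown to the processes, such that the address $R[x]$, when used by $p_i$, denotes the register $R[f_i(x)]$. A step of a process on a register is an atomic read, an atomic write, or an atomic $\mathrm{compare\&swap}(R[x],old,new)$, which assigns $new$ to $R[x]$ and returns true if $R[x]=old$, and otherwise leaves $R[x]$ unchanged and returns false. Steps of different processes are interleaved arbitrarily. A mutual exclusion algorithm consists of the code of two operations, $\mathrm{acquire}()$ and $\mathrm{release}()$. Each process repeats the cycle "$\mathrm{acquire}()$; critical section; $\mathrm{release}()$" any number of times, possibly zero, and starts each cycle at a time of its own choice. A process is in its critical section from the return of $\mathrm{acquire}()$ to the invocation of $\mathrm{release}()$. A run is fair if every process that has a pending operation keeps taking steps and every process in its critical section eventually invokes $\mathrm{release}()$. The algorithm is a *deadlock-free mutual exclusion algorithm* if, for all permutations $f_1,\dots,f_n$,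 * (mutual exclusion) in every run, no two processes are ever simultaneously in their critical sections, and * (deadlock-freedom) in every fair run, whenever some process has a pending $\mathrm{acquire}()$ and no process is in its critical section, some process eventually enters its critical section. **Theorem.** Let $n\ge 2$ and $m\ge 1$. There is a deadlock-free mutual exclusion algorithm for $n$ anonymous processes communicating through $m$ anonymous RMW registers if and only if $m\in M(n)$, where $$M(n)=\{\,m : \gcd(\ell,m)=1 \text{ for every integer } \ell \text{ with } 1<\ell\le n\,\}.$$ The same equivalence holds if, in addition, every invocation of $\mathrm{release}()$ is required to terminate in every fair run. -/

import Mathlib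

namespace FullyAnonymous

/-- The set `M(n)` of the memory sizes `m` with `gcd(ℓ, m) = 1` for every `1 < ℓ ≤ n`. -/
def M (n : ℕ) : Set ℕ :=
  {m | ∀ ℓ : ℕ, 1 < ℓ → ℓ ≤ n → Nat.gcd ℓ m = 1}

/-- What the code of a process does next: one atomic operation on the register with a given local
address, together with the local state that results from the response, or the return of the
operation that is being executed. -/
inductive Instr (Value State : Type) (m : ℕ) : Type where
  /-- Read the register; the new local state depends on the value read. -/
  | read (x : Fin m) (next : Value → State)
  /-- Write a value into the register. -/
  | write (x : Fin m) (v : Value) (next : State)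
  /-- `compare&swap(R[x], old, new)`; the new local state depends on the Boolean returned. -/
  | cas (x : Fin m) (old new : Value) (next : Bool → State)
  /-- Return from the operation `acquire()` or `release()`. -/
  | ret (next : State)

/-- A mutual exclusion algorithm for anonymous processes and `m` registers: the common (deterministic)
code of the operations `acquire()` and `release()`, over an arbitrary set of register values and an
arbitrary set of local states (local variables and control location). All the processes run this
code from the same initial local state and no process has an identity. Local states
persist from one invocation to the next one. -/
structure Algorithm (m : ℕ) where
  /-- The values that a register can hold. -/
  Value : Type
  /-- The common initial value `⊥` of all the registers. -/
  bot : Value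
  /-- The local states of a process. -/
  State : Type
  /-- The common initial local state of all the processes. -/
  start : State
  /-- The code of `acquire()`. -/
  acquire : State → Instr Value State m
  /-- The code of `release()`. -/
  release : State → Instr Value State m

/-- Where a process is in its cycle `acquire(); critical section; release()`. -/
inductive Phase : Type where
  /-- No operation pending and not in the critical section. -/
  | remainder
  /-- The operation `acquire()` is pending. -/
  | trying
  /-- In the critical section. -/
  | critical
  /-- The operation `release()` is pending. -/
  | releasing

/-- A global state of `n` processes that run the algorithm `A` over `m` registers. The registers
are listed under the names they have for an external observer. -/
structure Config {m : ℕ} (A : Algorithm m) (n : ℕ) where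
  mem : Fin m → A.Value
  phase : Fin n → Phase
  loc : Fin n → A.State

/-- Initially all registers hold `⊥`, and all the processes are in the remainder with the same
local state. -/
def Config.initial {m : ℕ} (A : Algorithm m) (n : ℕ) : Config A n where
  mem := fun _ => A.bot
  phase := fun _ => Phase.remainder
  loc := fun _ => A.start

open Classical in
/-- Process `i` executes one instruction atomically. Its address `R[x]` denotes the register
`R[f i x]`. The phase `after` is the one that it reaches if the instruction is a return. -/
noncomputable def Config.exec {m n : ℕ} {A : Algorithm m} (f : Fin n → Equiv.Perm (Fin m))
    (c : Config A n) (i : Fin n) (after : Phase) : Instr A.Value A.State m → Config A n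
  | Instr.read x next =>
      { c with loc := Function.update c.loc i (next (c.mem (f i x))) }
  | Instr.write x v next =>
      { c with
        mem := Function.update c.mem (f i x) v
        loc := Function.update c.loc i next }
  | Instr.cas x old new next =>
      if c.mem (f i x) = old then
        { c with
          mem := Function.update c.mem (f i x) new
          loc := Function.update c.loc i (next true) }
      else
        { c with loc := Function.update c.loc i (next false) }
  | Instr.ret next =>
      { c with
        phase := Function.update c.phase i after
        loc := Function.update c.loc i next }

/-- One step of process `i`: in the remainder it invokes `acquire()`, in the critical section it
leaves it and invokes `release()`, and while an operation is pending it executes the next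
instruction of that operation. -/
noncomputable def Config.step {m n : ℕ} {A : Algorithm m} (f : Fin n → Equiv.Perm (Fin m))
    (c : Config A n) (i : Fin n) : Config A n :=
  match c.phase i with
  | Phase.remainder => { c with phase := Function.update c.phase i Phase.trying }
  | Phase.trying => c.exec f i Phase.critical (A.acquire (c.loc i))
  | Phase.critical => { c with phase := Function.update c.phase i Phase.releasing }
  | Phase.releasing => c.exec f i Phase.remainder (A.release (c.loc i))

/-- The run of `A` with address permutations `f` under the schedule `σ`: at time `t` the process
`σ t` takes a step, or nothing happens if `σ t = none`. -/
noncomputable def run {m n : ℕ} (A : Algorithm m) (f : Fin n → Equiv.Perm (Fin m))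
    (σ : ℕ → Option (Fin n)) : ℕ → Config A n
  | 0 => Config.initial A n
  | t + 1 =>
    match σ t with
    | none => run A f σ t
    | some i => (run A f σ t).step f i

/-- No process stops outside the remainder: a process that has a pending operation keeps taking
steps, and a process in the critical section eventually invokes `release()`. A process in the
remainder may invoke `acquire()` again or stay there forever. -/
def Fair {m n : ℕ} (A : Algorithm m) (f : Fin n → Equiv.Perm (Fin m))
    (σ : ℕ → Option (Fin n)) : Prop :=
  ∀ (i : Fin n) (t : ℕ), (run A f σ t).phase i ≠ Phase.remainder → ∃ t' ≥ t, σ t' = some i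

/-- Mutual exclusion among `n` processes: whatever the address permutations and the schedule, no
two processes are simultaneously in the critical section. -/
def Algorithm.MutualExclusion {m : ℕ} (A : Algorithm m) (n : ℕ) : Prop :=
  ∀ (f : Fin n → Equiv.Perm (Fin m)) (σ : ℕ → Option (Fin n)) (t : ℕ) (i j : Fin n),
    (run A f σ t).phase i = Phase.critical → (run A f σ t).phase j = Phase.critical → i = j

/-- Deadlock-freedom among `n` processes: whatever the address permutations and the fair schedule,
if a process has a pending `acquire()` and no process is in the critical section, then
some process eventually enters the critical section. -/
def Algorithm.DeadlockFree {m : ℕ} (A : Algorithm m) (n : ℕ) : Prop :=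
  ∀ (f : Fin n → Equiv.Perm (Fin m)) (σ : ℕ → Option (Fin n)), Fair A f σ →
    ∀ t : ℕ, (∃ i, (run A f σ t).phase i = Phase.trying) →
      (∀ i, (run A f σ t).phase i ≠ Phase.critical) →
      ∃ t' > t, ∃ j, (run A f σ t').phase j = Phase.critical

/-- Every invocation of `release()` terminates, whatever the address permutations and the fair
schedule. -/
def Algorithm.ReleaseTerminates {m : ℕ} (A : Algorithm m) (n : ℕ) : Prop :=
  ∀ (f : Fin n → Equiv.Perm (Fin m)) (σ : ℕ → Option (Fin n)), Fair A f σ →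
    ∀ (t : ℕ) (i : Fin n), (run A f σ t).phase i = Phase.releasing →
      ∃ t' > t, (run A f σ t').phase i = Phase.remainder

end FullyAnonymous

/-!
Necessity. If `m ∉ M n`, some `ℓ` with `1 < ℓ ≤ n` divides `m`. Let `ρ` be a permutation of the
registers all of whose cycles have length `ℓ`, let process `i < ℓ` use the addresses `ρ ^ i`, and
schedule these `ℓ` processes in rounds. In each round they execute the same instruction on
different registers with the same content, so after each round they are in the same phase and the
same local state and the memory is invariant under `ρ` (`Symmetric.round`). If one of them entered
the critical section, all would, against mutual exclusion; if none ever does, deadlock-freedom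
fails.

Sufficiency. In the algorithm `race`, a process waits until it has seen each register free and then
captures free registers one by one, tagging the `k`-th one with `k`. It withdraws when it reads a
tag larger than the number of the registers it owns, and it enters the critical section when it
owns all `m` registers. Mutual exclusion holds because no register has two owners.

For deadlock-freedom, suppose that some process is trying and no process is in the critical section
from some time on. Let `K` be the largest number of registers that contending processes own at
arbitrarily late times. Eventually no tag exceeds `K` (`RaceRun.eventually_mem_le`), `K` is
positive (`RaceRun.bound_pos`), and a process that contends with `K` registers never withdraws and
never captures another one (`RaceRun.leader_forever`), so that a register with tag `K` persists.
Every other process either reads this tag and withdraws, after which this register keeps it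
waiting, or comes to own `K` registers itself (`RaceRun.eventually_wait_or_leader`). Finally all
registers are owned, `K` of them by each of at most `n` processes. The number of these owners
divides `m ∈ M n`, so there is a single one (`RaceRun.eq_of_all_owned`). It owns all the registers
and enters the critical section, a contradiction.
-/

namespace FullyAnonymous

/-! ### Necessity: a symmetric schedule -/

/-- A step depends only on the phase, the local state and the content of one register, and
changes only these. A step without a write counts as writing back the value of the register. -/
lemma exists_step_eq {m n : ℕ} (hm : 1 ≤ m) (A : Algorithm m) (f : Fin n → Equiv.Perm (Fin m))
    (p : Phase) (s : A.State) (M : Fin m → A.Value) :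
    ∃ (p' : Phase) (s' : A.State) (x : Fin m) (v : A.Value), ∀ (c : Config A n) (i : Fin n),
      c.phase i = p → c.loc i = s → c.mem (f i x) = M x →
      c.step f i = { mem := Function.update c.mem (f i x) v
                     phase := Function.update c.phase i p'
                     loc := Function.update c.loc i s' } := by
  have exec : ∀ (after : Phase) (ins : Instr A.Value A.State m),
      ∃ (p' : Phase) (s' : A.State) (x : Fin m) (v : A.Value), ∀ (c : Config A n) (i : Fin n),
      c.phase i = p → c.loc i = s → c.mem (f i x) = M x →
      c.exec f i after ins = { mem := Function.update c.mem (f i x) v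
                               phase := Function.update c.phase i p'
                               loc := Function.update c.loc i s' } := by
    intro after ins
    cases ins with
    | read x next =>
      refine ⟨p, next (M x), x, M x, fun c i hp hs hM => ?_⟩
      simp [Config.exec, ← hM, ← hp]
    | write x v next =>
      refine ⟨p, next, x, v, fun c i hp hs hM => ?_⟩
      simp [Config.exec, ← hp]
    | cas x old new next =>
      by_cases h : M x = old
      · refine ⟨p, next true, x, new, fun c i hp hs hM => ?_⟩
        simp [Config.exec, ← hp, hM, h]
      · refine ⟨p, next false, x, M x, fun c i hp hs hM => ?_⟩
        rw [Config.exec, if_neg (by rwa [hM])]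
        simp [← hp, ← hM]
    | ret next =>
      refine ⟨after, next, ⟨0, hm⟩, M ⟨0, hm⟩, fun c i hp hs hM => ?_⟩
      simp [Config.exec, ← hM]
  cases p with
  | remainder =>
    refine ⟨.trying, s, ⟨0, hm⟩, M ⟨0, hm⟩, fun c i hp hs hM => ?_⟩
    simp [Config.step, hp, ← hM, ← hs]
  | critical =>
    refine ⟨.releasing, s, ⟨0, hm⟩, M ⟨0, hm⟩, fun c i hp hs hM => ?_⟩
    simp [Config.step, hp, ← hM, ← hs]
  | trying =>
    obtain ⟨p', s', x, v, h⟩ := exec .critical (A.acquire s)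
    refine ⟨p', s', x, v, fun c i hp hs hM => ?_⟩
    rw [← h c i hp hs hM]
    simp [Config.step, hp, hs]
  | releasing =>
    obtain ⟨p', s', x, v, h⟩ := exec .remainder (A.release s)
    refine ⟨p', s', x, v, fun c i hp hs hM => ?_⟩
    rw [← h c i hp hs hM]
    simp [Config.step, hp, hs]

/-- If `ℓ` divides `m`, some permutation of `m` points has order `ℓ` and all its cycles have
length `ℓ`: the rotation by `m / ℓ`. -/
lemma exists_perm_of_dvd {ℓ m : ℕ} (hm : 1 ≤ m) (h : ℓ ∣ m) :
    ∃ ρ : Equiv.Perm (Fin m), ρ ^ ℓ = 1 ∧ ∀ x, ∀ k, 0 < k → k < ℓ → (ρ ^ k) x ≠ x := by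
  obtain ⟨d, rfl⟩ := h
  have hd : 0 < d := Nat.pos_of_mul_pos_left hm
  have : NeZero (ℓ * d) := ⟨by omega⟩
  have hpow : ∀ k : ℕ, (Equiv.addRight (Fin.ofNat (ℓ * d) d)) ^ k =
      Equiv.addRight (Fin.ofNat (ℓ * d) (k * d)) := by
    intro k
    induction k with
    | zero => ext x; simp
    | succ k ih =>
      rw [pow_succ, ih]
      ext x
      simp only [Equiv.Perm.coe_mul, Function.comp_apply, Equiv.coe_addRight, Fin.val_add,
        Fin.val_ofNat]
      simp only [Nat.add_mod_mod, Nat.mod_add_mod]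
      congr 1
      ring
  refine ⟨Equiv.addRight (Fin.ofNat (ℓ * d) d), ?_, fun x k hk hkℓ => ?_⟩
  · rw [hpow]
    ext x
    simp
  · rw [hpow]
    intro h
    have h2 : Fin.ofNat (ℓ * d) (k * d) = 0 := by simpa using h
    have h3 := congrArg Fin.val h2
    rw [Fin.val_ofNat, Fin.val_zero, Nat.mod_eq_of_lt (Nat.mul_lt_mul_of_pos_right hkℓ hd)] at h3
    have := Nat.mul_pos hk hd
    omega

/-- Processes `0, …, ℓ - 1` are in the same phase and the same local state and the memory is
invariant under `ρ`; the other processes are in the remainder. -/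
structure Symmetric {m n : ℕ} {A : Algorithm m} (ρ : Equiv.Perm (Fin m)) (ℓ : ℕ)
    (c : Config A n) (p : Phase) (s : A.State) : Prop where
  mem : ∀ x, c.mem (ρ x) = c.mem x
  phase : ∀ i : Fin n, (i : ℕ) < ℓ → c.phase i = p
  loc : ∀ i : Fin n, (i : ℕ) < ℓ → c.loc i = s
  rest : ∀ i : Fin n, ℓ ≤ (i : ℕ) → c.phase i = .remainder

/-- A round, in which the processes `0, …, ℓ - 1` take one step each, preserves symmetry: they
execute the same instruction on registers that are different but have the same content. -/
lemma Symmetric.round {m n ℓ : ℕ} (hm : 1 ≤ m) (hℓ : 0 < ℓ) (hℓn : ℓ ≤ n) {A : Algorithm m}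
    {ρ : Equiv.Perm (Fin m)} (hρ : ρ ^ ℓ = 1) (hfix : ∀ x, ∀ k, 0 < k → k < ℓ → (ρ ^ k) x ≠ x)
    {c : ℕ → Config A n}
    (hc : ∀ (k : ℕ) (hk : k < ℓ),
      c (k + 1) = (c k).step (fun i : Fin n => ρ ^ (i : ℕ)) ⟨k, hk.trans_le hℓn⟩)
    {p : Phase} {s : A.State} (h : Symmetric ρ ℓ (c 0) p s) :
    ∃ p' s', Symmetric ρ ℓ (c ℓ) p' s' ∧
      ∀ k ≤ ℓ, ∀ i : Fin n,
        (c k).phase i = p ∨ (c k).phase i = p' ∨ (c k).phase i = .remainder := by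
  obtain ⟨p', s', x, v, hstep⟩ :=
    exists_step_eq hm A (fun i : Fin n => ρ ^ (i : ℕ)) p s (c 0).mem
  have hinv : ∀ (k : ℕ) (y : Fin m), (c 0).mem ((ρ ^ k) y) = (c 0).mem y := by
    intro k
    induction k with
    | zero => simp
    | succ k ih => intro y; rw [pow_succ, Equiv.Perm.mul_apply, ih, h.mem]
  have hne : ∀ a b, a < b → b < ℓ → (ρ ^ b) x ≠ (ρ ^ a) x := by
    intro a b hab hb heq
    apply hfix x (b - a) (by omega) (by omega)
    apply (ρ ^ a).injective
    rw [← Equiv.Perm.mul_apply, ← pow_add, Nat.add_sub_cancel' hab.le, heq]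
  have key : ∀ k ≤ ℓ,
      (∀ y, (∀ a < k, y ≠ (ρ ^ a) x) → (c k).mem y = (c 0).mem y) ∧
      (∀ a < k, (c k).mem ((ρ ^ a) x) = v) ∧
      (∀ i : Fin n, (i : ℕ) < k → (c k).phase i = p' ∧ (c k).loc i = s') ∧
      (∀ i : Fin n, k ≤ (i : ℕ) → (c k).phase i = (c 0).phase i ∧ (c k).loc i = (c 0).loc i) := by
    intro k
    induction k with
    | zero => intro _; simp
    | succ k ih =>
      intro hk
      obtain ⟨h1, h2, h3, h4⟩ := ih (by omega)
      have hk' : k < n := by omega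
      have e := hstep (c k) ⟨k, hk'⟩ ((h4 ⟨k, hk'⟩ le_rfl).1.trans (h.phase _ hk))
        ((h4 ⟨k, hk'⟩ le_rfl).2.trans (h.loc _ hk))
        (by rw [h1 _ fun a ha => hne a k ha hk]; exact hinv k x)
      rw [hc k hk, e]
      refine ⟨fun y hy => ?_, fun a ha => ?_, fun i hi => ?_, fun i hi => ?_⟩
      · simp only
        rw [Function.update_of_ne (hy k (by omega)), h1 y fun a ha => hy a (by omega)]
      · simp only
        rcases Nat.lt_succ_iff_lt_or_eq.1 ha with ha | rfl
        · rw [Function.update_of_ne (hne a k ha hk).symm, h2 a ha]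
        · simp
      · simp only
        rcases Nat.lt_succ_iff_lt_or_eq.1 hi with hi | hi
        · have : i ≠ ⟨k, hk'⟩ := fun e => by simp [e] at hi
          rw [Function.update_of_ne this, Function.update_of_ne this]
          exact h3 i hi
        · have : i = ⟨k, hk'⟩ := Fin.ext hi
          subst this
          simp
      · have : i ≠ ⟨k, hk'⟩ := fun e => by simp [e] at hi
        simp only
        rw [Function.update_of_ne this, Function.update_of_ne this]
        exact h4 i (by omega)
  refine ⟨p', s', ?_, fun k hk i => ?_⟩
  · obtain ⟨h1, h2, h3, h4⟩ := key ℓ le_rfl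
    refine ⟨fun y => ?_, fun i hi => (h3 i hi).1, fun i hi => (h3 i hi).2,
      fun i hi => (h4 i hi).1.trans (h.rest i hi)⟩
    by_cases hy : ∃ a < ℓ, y = (ρ ^ a) x
    · obtain ⟨a, ha, rfl⟩ := hy
      rw [h2 a ha, ← Equiv.Perm.mul_apply, ← pow_succ']
      rcases Nat.lt_or_ge (a + 1) ℓ with ha' | ha'
      · exact h2 _ ha'
      · rw [show a + 1 = ℓ by omega, hρ]
        exact h2 0 hℓ
    · push Not at hy
      rw [h1 y hy, h1, h.mem]
      -- If `ρ y` is on the cycle of `x`, then so is `y`.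
      intro a ha heq
      rcases Nat.eq_zero_or_pos a with rfl | ha0
      · refine hy (ℓ - 1) (by omega) (ρ.injective ?_)
        rw [heq, ← Equiv.Perm.mul_apply, ← pow_succ', Nat.sub_add_cancel hℓ, hρ, pow_zero]
      · refine hy (a - 1) (by omega) (ρ.injective ?_)
        rw [heq, ← Equiv.Perm.mul_apply, ← pow_succ', Nat.sub_add_cancel ha0]
  · obtain ⟨-, -, h3, h4⟩ := key k hk
    rcases Nat.lt_or_ge (i : ℕ) k with hi | hi
    · exact Or.inr (Or.inl (h3 i hi).1)
    · rw [(h4 i hi).1]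
      rcases Nat.lt_or_ge (i : ℕ) ℓ with hi' | hi'
      · exact Or.inl (h.phase i hi')
      · exact Or.inr (Or.inr (h.rest i hi'))

/-- If `1 < ℓ ≤ n` and `ℓ ∣ m`, then `ℓ` processes that run in lockstep on a rotated memory stay
symmetric forever, so that none of them can enter the critical section alone. -/
theorem not_deadlockFree_of_dvd {n m ℓ : ℕ} (hm : 1 ≤ m) (hℓ : 1 < ℓ) (hℓn : ℓ ≤ n) (hdvd : ℓ ∣ m)
    (A : Algorithm m) (hmx : A.MutualExclusion n) : ¬ A.DeadlockFree n := by
  intro hdf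
  obtain ⟨ρ, hρ, hfix⟩ := exists_perm_of_dvd hm hdvd
  have hmod : ∀ t, t % ℓ < n := fun t => (Nat.mod_lt t (by omega)).trans_le hℓn
  set f : Fin n → Equiv.Perm (Fin m) := fun i => ρ ^ (i : ℕ) with hf
  set σ : ℕ → Option (Fin n) := fun t => some ⟨t % ℓ, hmod t⟩ with hσ
  have hrun : ∀ t, run A f σ (t + 1) = (run A f σ t).step f ⟨t % ℓ, hmod t⟩ := fun t => rfl
  have hround : ∀ r p s, Symmetric ρ ℓ (run A f σ (ℓ * r)) p s →
      ∃ p' s', Symmetric ρ ℓ (run A f σ (ℓ * (r + 1))) p' s' ∧ ∀ k ≤ ℓ, ∀ i : Fin n,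
        (run A f σ (ℓ * r + k)).phase i = p ∨ (run A f σ (ℓ * r + k)).phase i = p' ∨
          (run A f σ (ℓ * r + k)).phase i = .remainder := by
    intro r p s h
    refine Symmetric.round (c := fun k => run A f σ (ℓ * r + k)) hm (by omega) hℓn hρ hfix
      (fun k hk => ?_) h
    simp only [← add_assoc, hrun]
    congr 2
    rw [Nat.mul_add_mod, Nat.mod_eq_of_lt hk]
  have hsym : ∀ r, ∃ p s, Symmetric ρ ℓ (run A f σ (ℓ * r)) p s := by
    intro r
    induction r with
    | zero =>
      exact ⟨.remainder, A.start, fun _ => rfl, fun _ _ => rfl, fun _ _ => rfl, fun _ _ => rfl⟩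
    | succ r ih =>
      obtain ⟨p, s, h⟩ := ih
      obtain ⟨p', s', h', -⟩ := hround r p s h
      exact ⟨p', s', h'⟩
  have hncrit : ∀ r p s, Symmetric ρ ℓ (run A f σ (ℓ * r)) p s → p ≠ .critical := by
    rintro r p s h rfl
    have := hmx f σ (ℓ * r) ⟨0, by omega⟩ ⟨1, by omega⟩ (h.phase _ (by simp; omega))
      (h.phase _ (by simpa))
    simp at this
  have hphase : ∀ t, ∀ i : Fin n, (run A f σ t).phase i ≠ .critical := by
    intro t i hcrit
    obtain ⟨p, s, h⟩ := hsym (t / ℓ)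
    obtain ⟨p', s', h', hall⟩ := hround _ p s h
    have := hall (t % ℓ) (Nat.mod_lt _ (by omega)).le i
    rw [Nat.div_add_mod, hcrit] at this
    rcases this with e | e | e
    · exact hncrit _ _ _ h e.symm
    · exact hncrit _ _ _ h' e.symm
    · cases e
  have hrest : ∀ t, ∀ i : Fin n, ℓ ≤ (i : ℕ) → (run A f σ t).phase i = .remainder := by
    intro t i hi
    induction t with
    | zero => rfl
    | succ t ih =>
      have hne : i ≠ ⟨t % ℓ, hmod t⟩ := by
        intro e
        have := Nat.mod_lt t (show 0 < ℓ by omega)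
        simp [e] at hi
        omega
      obtain ⟨p', s', x, v, hstep⟩ := exists_step_eq hm A f
        ((run A f σ t).phase ⟨t % ℓ, hmod t⟩) ((run A f σ t).loc ⟨t % ℓ, hmod t⟩)
        (fun y => (run A f σ t).mem (f ⟨t % ℓ, hmod t⟩ y))
      rw [hrun, hstep _ _ rfl rfl rfl]
      simp only
      rw [Function.update_of_ne hne, ih]
  have hfair : Fair A f σ := by
    intro i t hi
    have hiℓ : (i : ℕ) < ℓ := by
      by_contra hcon
      exact hi (hrest t i (by omega))
    refine ⟨ℓ * t + i, ?_, ?_⟩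
    · nlinarith
    · simp only [hσ, Option.some.injEq]
      apply Fin.ext
      simp [Nat.mod_eq_of_lt hiℓ]
  obtain ⟨t', -, j, hj⟩ := hdf f σ hfair 1
    ⟨⟨0 % ℓ, hmod 0⟩, by rw [hrun 0]; simp [run, Config.initial, Config.step]⟩ (hphase 1)
  exact hphase t' j hj

/-- A memory size that admits a deadlock-free mutual exclusion algorithm belongs to `M n`. -/
theorem mem_M_of_algorithm {n m : ℕ} (hm : 1 ≤ m) (A : Algorithm m)
    (hmx : A.MutualExclusion n) (hdf : A.DeadlockFree n) : m ∈ M n := by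
  intro ℓ hℓ hℓn
  by_contra hg
  have hpos : 0 < Nat.gcd ℓ m := Nat.gcd_pos_of_pos_left _ (by omega)
  exact not_deadlockFree_of_dvd hm (by omega)
    ((Nat.le_of_dvd (by omega) (Nat.gcd_dvd_left ℓ m)).trans hℓn) (Nat.gcd_dvd_right ℓ m) A hmx hdf

/-! ### The algorithm -/

/-- The local states of a process that runs the race algorithm. The sets consist of local register
addresses; `S` always is the set of the registers that the process owns. -/
inductive Loc (m : ℕ) : Type where
  /-- Waiting until each of the registers in `W` has been seen free, or being in the remainder. The
  process owns nothing. -/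
  | wait (W : Finset (Fin m))
  /-- Contending, about to try to capture a register in `Q`, the rest of the current scan. -/
  | scan (S Q : Finset (Fin m))
  /-- Contending, about to read the register of `Q` whose capture has just failed. -/
  | look (S Q : Finset (Fin m))
  /-- Giving back the registers in `S`, or being in the critical section. -/
  | drop (S : Finset (Fin m))

/-- The registers owned in a local state. -/
def Loc.owned {m : ℕ} : Loc m → Finset (Fin m)
  | .wait _ => ∅
  | .scan S _ => S
  | .look S _ => S
  | .drop S => S

/-- The local states of a process that takes part in the race for the registers. -/
def Loc.Contending {m : ℕ} : Loc m → Prop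
  | .wait _ => False
  | .scan _ _ => True
  | .look _ _ => True
  | .drop _ => False

open Classical in
/-- Some element of `Q`, and a junk value if `Q` is empty. -/
noncomputable def pick {m : ℕ} [NeZero m] (Q : Finset (Fin m)) : Fin m :=
  if h : Q.Nonempty then h.choose else 0

lemma pick_mem {m : ℕ} [NeZero m] {Q : Finset (Fin m)} (h : Q.Nonempty) : pick Q ∈ Q := by
  rw [pick, dif_pos h]
  exact h.choose_spec

open Classical in
/-- The race algorithm. A free register holds `0`, a register owned by a process holds a number
between `1` and the number of registers that this process has captured, its tag. A process waits
until it has seen every register free and then tries to capture registers one by one, tagging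
the `k`-th one with `k`. If it reads a tag greater than the number of the registers it owns,
it withdraws: it gives back all its registers and starts again. When it owns all the registers, it
enters the critical section; `release()` gives back all the registers. Where a transition needs no
operation on the memory, a read with an ignored result is performed. -/
noncomputable def race (m : ℕ) [NeZero m] : Algorithm m where
  Value := ℕ
  bot := 0
  State := Loc m
  start := .wait Finset.univ
  acquire
    | .wait W => .read (pick W) fun v =>
        if W = ∅ then .scan ∅ Finset.univ
        else if v = 0 then .wait (W.erase (pick W)) else .wait W
    | .scan S Q =>
        if S = Finset.univ then .ret (.drop S)
        else if Q = ∅ then .read (pick Q) fun _ => .scan S Finset.univ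
        else .cas (pick Q) 0 (S.card + 1) fun b =>
          if b then .scan (insert (pick Q) S) (Q.erase (pick Q)) else .look S Q
    | .look S Q => .read (pick Q) fun v =>
        if S.card < v then .drop S else .scan S (Q.erase (pick Q))
    | .drop S =>
        if S = ∅ then .read (pick S) fun _ => .wait Finset.univ
        else .write (pick S) 0 (.drop (S.erase (pick S)))
  release
    | .drop S =>
        if S = ∅ then .ret (.wait Finset.univ)
        else .write (pick S) 0 (.drop (S.erase (pick S)))
    | _ => .ret (.wait Finset.univ)

/-- The steps of a process running the race algorithm: `Move μ p l p' l' w` says that a process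
that sees the memory content `μ` through its addresses can go from phase `p` and local state `l`
to phase `p'` and local state `l'` by writing as described by `w`. -/
inductive Move {m : ℕ} [NeZero m] (μ : Fin m → ℕ) :
    Phase → Loc m → Phase → Loc m → Option (Fin m × ℕ) → Prop where
  | invokeAcquire (l) : Move μ .remainder l .trying l none
  | invokeRelease (l) : Move μ .critical l .releasing l none
  | waitDone : Move μ .trying (.wait ∅) .trying (.scan ∅ Finset.univ) none
  | waitPass (W) (hW : W.Nonempty) (h : μ (pick W) = 0) :
      Move μ .trying (.wait W) .trying (.wait (W.erase (pick W))) none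
  | waitStay (W) (hW : W.Nonempty) (h : μ (pick W) ≠ 0) :
      Move μ .trying (.wait W) .trying (.wait W) none
  | enter (Q) : Move μ .trying (.scan Finset.univ Q) .critical (.drop Finset.univ) none
  | rescan (S) (hS : S ≠ Finset.univ) :
      Move μ .trying (.scan S ∅) .trying (.scan S Finset.univ) none
  | capture (S Q) (hS : S ≠ Finset.univ) (hQ : Q.Nonempty) (h : μ (pick Q) = 0) :
      Move μ .trying (.scan S Q) .trying (.scan (insert (pick Q) S) (Q.erase (pick Q)))
        (some (pick Q, S.card + 1))
  | blocked (S Q) (hS : S ≠ Finset.univ) (hQ : Q.Nonempty) (h : μ (pick Q) ≠ 0) :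
      Move μ .trying (.scan S Q) .trying (.look S Q) none
  | withdraw (S Q) (h : S.card < μ (pick Q)) : Move μ .trying (.look S Q) .trying (.drop S) none
  | proceed (S Q) (h : μ (pick Q) ≤ S.card) :
      Move μ .trying (.look S Q) .trying (.scan S (Q.erase (pick Q))) none
  | giveBack (p) (hp : p = .trying ∨ p = .releasing) (S) (hS : S.Nonempty) :
      Move μ p (.drop S) p (.drop (S.erase (pick S))) (some (pick S, 0))
  | withdrawn : Move μ .trying (.drop ∅) .trying (.wait Finset.univ) none
  | released : Move μ .releasing (.drop ∅) .remainder (.wait Finset.univ) none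

/-- The memory after the write `w` of a process with address permutation `π`. -/
def applyWrite {m : ℕ} (π : Equiv.Perm (Fin m)) (M : Fin m → ℕ) : Option (Fin m × ℕ) → Fin m → ℕ
  | none => M
  | some (x, v) => Function.update M (π x) v

/-- The steps of the race algorithm are described by `Move`. -/
lemma exists_move {m n : ℕ} [NeZero m] (f : Fin n → Equiv.Perm (Fin m)) (c : Config (race m) n)
    (i : Fin n) (hrel : c.phase i = .releasing → ∃ S, c.loc i = Loc.drop S) :
    ∃ p' l' w, Move (fun x => c.mem (f i x)) (c.phase i) (c.loc i) p' l' w ∧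
      c.step f i = { mem := applyWrite (f i) c.mem w
                     phase := Function.update c.phase i p'
                     loc := Function.update c.loc i l' } := by
  obtain ⟨mem, phase, loc⟩ := c
  dsimp only at hrel ⊢
  have hu : Function.update phase i (phase i) = phase := Function.update_eq_self _ _
  cases hp : phase i with
  | remainder =>
    exact ⟨_, _, _, .invokeAcquire _, by simp [Config.step, hp, applyWrite]⟩
  | critical =>
    exact ⟨_, _, _, .invokeRelease _, by simp [Config.step, hp, applyWrite]⟩
  | trying =>
    rw [hp] at hu
    cases hl : loc i with
    | wait W =>
      rcases W.eq_empty_or_nonempty with rfl | hW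
      · exact ⟨_, _, _, .waitDone,
          by simp [Config.step, hp, hl, race, Config.exec, applyWrite, hu]⟩
      · by_cases h : mem (f i (pick W)) = (0 : ℕ)
        · exact ⟨_, _, _, .waitPass W hW h,
            by simp [Config.step, hp, hl, race, Config.exec, applyWrite, hu, hW.ne_empty, h]⟩
        · refine ⟨_, _, _, .waitStay W hW h, ?_⟩
          simp only [Config.step, hp, hl, race, Config.exec, applyWrite, hu, hW.ne_empty, if_false]
          split_ifs with h'
          · exact absurd h' h
          · rfl
    | scan S Q =>
      by_cases hS : S = Finset.univ
      · subst hS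
        exact ⟨_, _, _, .enter Q,
          by simp [Config.step, hp, hl, race, Config.exec, applyWrite]⟩
      · rcases Q.eq_empty_or_nonempty with rfl | hQ
        · exact ⟨_, _, _, .rescan S hS,
            by simp [Config.step, hp, hl, race, Config.exec, applyWrite, hu, hS]⟩
        · by_cases h : mem (f i (pick Q)) = (0 : ℕ)
          · exact ⟨_, _, _, .capture S Q hS hQ h,
              by simp [Config.step, hp, hl, race, Config.exec, applyWrite, hu, hS, hQ.ne_empty,
                h]⟩
          · refine ⟨_, _, _, .blocked S Q hS hQ h, ?_⟩
            simp only [Config.step, hp, hl, race, Config.exec, applyWrite, hu, hS, hQ.ne_empty,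
              if_false]
            exact if_neg h
    | look S Q =>
      by_cases h : S.card < (mem (f i (pick Q)) : ℕ)
      · exact ⟨_, _, _, .withdraw S Q h,
          by simp [Config.step, hp, hl, race, Config.exec, applyWrite, hu, h]⟩
      · exact ⟨_, _, _, .proceed S Q (not_lt.1 h),
          by simp [Config.step, hp, hl, race, Config.exec, applyWrite, hu, h]⟩
    | drop S =>
      rcases S.eq_empty_or_nonempty with rfl | hS
      · exact ⟨_, _, _, .withdrawn,
          by simp [Config.step, hp, hl, race, Config.exec, applyWrite, hu]⟩
      · exact ⟨_, _, _, .giveBack _ (Or.inl rfl) S hS,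
          by simp [Config.step, hp, hl, race, Config.exec, applyWrite, hu, hS.ne_empty]⟩
  | releasing =>
    rw [hp] at hu
    obtain ⟨S, hl⟩ := hrel hp
    rw [hl]
    rcases S.eq_empty_or_nonempty with rfl | hS
    · exact ⟨_, _, _, .released,
        by simp [Config.step, hp, hl, race, Config.exec, applyWrite]⟩
    · exact ⟨_, _, _, .giveBack _ (Or.inr rfl) S hS,
        by simp [Config.step, hp, hl, race, Config.exec, applyWrite, hu, hS.ne_empty]⟩

/-- The effect of a step on the ownership of the registers: none, or a free register is captured
and tagged with the new number of owned registers, or an owned register is given back. -/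
lemma Move.effect {m : ℕ} [NeZero m] {μ : Fin m → ℕ} {p p' : Phase} {l l' : Loc m}
    {w : Option (Fin m × ℕ)} (h : Move μ p l p' l' w) :
    (w = none ∧ l'.owned = l.owned ∧ (l'.Contending → l.Contending ∨ l'.owned = ∅)) ∨
    (∃ x, w = some (x, l.owned.card + 1) ∧ μ x = 0 ∧ l'.owned = insert x l.owned ∧
      l.Contending ∧ l'.Contending) ∨
    (∃ x ∈ l.owned, w = some (x, 0) ∧ l'.owned = l.owned.erase x ∧ ¬ l'.Contending) := by
  cases h with
  | capture S Q hS hQ h => exact Or.inr (Or.inl ⟨_, rfl, h, rfl, trivial, trivial⟩)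
  | giveBack p hp S hS => exact Or.inr (Or.inr ⟨_, pick_mem hS, rfl, rfl, id⟩)
  | _ =>
    refine Or.inl ⟨rfl, rfl, ?_⟩
    first
      | exact Or.inl
      | exact fun _ => Or.inl trivial
      | exact fun _ => Or.inr rfl

/-! ### Invariants -/

/-- The invariants of the race algorithm. -/
structure Inv {m n : ℕ} (f : Fin n → Equiv.Perm (Fin m)) (mem : Fin m → ℕ)
    (phase : Fin n → Phase) (loc : Fin n → Loc m) : Prop where
  remainder : ∀ i, phase i = .remainder → loc i = Loc.wait Finset.univ
  critical : ∀ i, phase i = .critical → loc i = Loc.drop Finset.univ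
  releasing : ∀ i, phase i = .releasing → ∃ S, loc i = Loc.drop S
  /-- No register has two owners. -/
  disjoint : ∀ i j x y, x ∈ (loc i).owned → y ∈ (loc j).owned →
    f i x = f j y → i = j
  /-- The registers that are not free are the owned ones. -/
  ne_zero_iff : ∀ y, mem y ≠ 0 ↔ ∃ i, ∃ x ∈ (loc i).owned, f i x = y
  /-- A contending process owns at least as many registers as its tags say. -/
  tag_le : ∀ i, (loc i).Contending → ∀ x ∈ (loc i).owned,
    mem (f i x) ≤ (loc i).owned.card
  /-- The last register captured by a contending process tells how many registers it owns. -/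
  exists_tag : ∀ i, (loc i).Contending → (loc i).owned.Nonempty →
    ∃ x ∈ (loc i).owned, mem (f i x) = (loc i).owned.card

lemma Inv.initial {m n : ℕ} (f : Fin n → Equiv.Perm (Fin m)) :
    Inv f (fun _ => 0) (fun _ => Phase.remainder) (fun _ => Loc.wait Finset.univ) where
  remainder _ _ := rfl
  critical _ h := by cases h
  releasing _ h := by cases h
  disjoint i j x y hx _ _ := by simp [Loc.owned] at hx
  ne_zero_iff y := by simp [Loc.owned]
  tag_le _ h := by cases h
  exists_tag _ h := by cases h

lemma Inv.step {m n : ℕ} [NeZero m] {f : Fin n → Equiv.Perm (Fin m)} {mem : Fin m → ℕ}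
    {phase : Fin n → Phase} {loc : Fin n → Loc m} (h : Inv f mem phase loc) (i : Fin n)
    {p' : Phase} {l' : Loc m} {w : Option (Fin m × ℕ)}
    (hmove : Move (fun x => mem (f i x)) (phase i) (loc i) p' l' w) :
    Inv f (applyWrite (f i) mem w) (Function.update phase i p') (Function.update loc i l') := by
  have hphase : (p' = .remainder → l' = Loc.wait Finset.univ) ∧
      (p' = .critical → l' = Loc.drop Finset.univ) ∧ (p' = .releasing → ∃ S, l' = Loc.drop S) := by
    have h1 := h.remainder i
    have h2 := h.critical i
    have h3 := h.releasing i
    revert h1 h2 h3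
    generalize phase i = p at hmove
    generalize loc i = l at hmove
    intro h1 h2 h3
    cases hmove with
    | invokeRelease => exact ⟨by simp, by simp, fun _ => ⟨_, h2 rfl⟩⟩
    | giveBack _ hp => rcases hp with rfl | rfl <;> simp
    | _ => simp
  have hloc : ∀ (P : Phase → Loc m → Prop), P p' l' → (∀ j, P (phase j) (loc j)) →
      ∀ j, P (Function.update phase i p' j) (Function.update loc i l' j) := by
    intro P hi hP j
    rcases eq_or_ne j i with rfl | hj
    · simpa using hi
    · simpa [hj] using hP j
  have hne : ∀ j ≠ i, Function.update loc i l' j = loc j := fun j hj =>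
    Function.update_of_ne hj _ _
  have hi : Function.update loc i l' i = l' := Function.update_self _ _ _
  -- It remains to treat the part of the invariant that does not mention the phases.
  suffices hmain : (∀ j k x y, x ∈ (Function.update loc i l' j).owned →
        y ∈ (Function.update loc i l' k).owned → f j x = f k y → j = k) ∧
      (∀ y, applyWrite (f i) mem w y ≠ 0 ↔
        ∃ j, ∃ x ∈ (Function.update loc i l' j).owned, f j x = y) ∧
      (∀ j, (Function.update loc i l' j).Contending →
        (∀ x ∈ (Function.update loc i l' j).owned,
          applyWrite (f i) mem w (f j x) ≤ (Function.update loc i l' j).owned.card) ∧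
        ((Function.update loc i l' j).owned.Nonempty →
          ∃ x ∈ (Function.update loc i l' j).owned,
            applyWrite (f i) mem w (f j x) =
              (Function.update loc i l' j).owned.card)) by
    exact ⟨hloc (fun p l => p = .remainder → l = Loc.wait Finset.univ) hphase.1 h.remainder,
      hloc (fun p l => p = .critical → l = Loc.drop Finset.univ) hphase.2.1 h.critical,
      hloc (fun p l => p = .releasing → ∃ S, l = Loc.drop S) hphase.2.2 h.releasing,
      hmain.1, hmain.2.1, fun j hj => (hmain.2.2 j hj).1, fun j hj => (hmain.2.2 j hj).2⟩
  rcases hmove.effect with ⟨rfl, ho, hc⟩ | ⟨x, rfl, hx0, ho, hc, -⟩ | ⟨x, hx, rfl, ho, hc⟩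
  · have ho' : ∀ j, (Function.update loc i l' j).owned = (loc j).owned := by
      intro j
      rcases eq_or_ne j i with rfl | hj
      · rw [hi, ho]
      · rw [hne j hj]
    simp only [ho', applyWrite]
    refine ⟨h.disjoint, h.ne_zero_iff, fun j hj => ?_⟩
    have hj' : (loc j).Contending ∨ (loc j).owned = ∅ := by
      rcases eq_or_ne j i with rfl | hji
      · rw [hi] at hj
        rw [← ho]
        exact hc hj
      · rw [hne j hji] at hj
        exact Or.inl hj
    rcases hj' with hj' | hj'
    · exact ⟨h.tag_le j hj', h.exists_tag j hj'⟩
    · simp [hj']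
  · have hfree : ∀ j, ∀ y ∈ (loc j).owned, f j y ≠ f i x := fun j y hy e =>
      (h.ne_zero_iff (f i x)).2 ⟨j, y, hy, e⟩ hx0
    have hxn : x ∉ (loc i).owned := fun hx => hfree i x hx rfl
    refine ⟨fun j k y z hy hz e => ?_, fun y => ?_, fun j hj => ?_⟩
    · rcases eq_or_ne j i with rfl | hj <;> rcases eq_or_ne k j with rfl | hk
      · rfl
      · rw [hi, ho, Finset.mem_insert] at hy
        rw [hne k hk] at hz
        rcases hy with rfl | hy
        · exact absurd e.symm (hfree k z hz)
        · exact h.disjoint _ _ _ _ hy hz e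
      · rfl
      · rw [hne j hj] at hy
        rcases eq_or_ne k i with rfl | hki
        · rw [hi, ho, Finset.mem_insert] at hz
          rcases hz with rfl | hz
          · exact absurd e (hfree j y hy)
          · exact h.disjoint _ _ _ _ hy hz e
        · rw [hne k hki] at hz
          exact h.disjoint _ _ _ _ hy hz e
    · rcases eq_or_ne y (f i x) with rfl | hy
      · simp only [applyWrite, Function.update_self]
        exact ⟨fun _ => ⟨i, x, by rw [hi, ho]; exact Finset.mem_insert_self _ _, rfl⟩,
          fun _ => by omega⟩
      · simp only [applyWrite, Function.update_of_ne hy]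
        refine (h.ne_zero_iff y).trans ⟨?_, ?_⟩
        · rintro ⟨j, z, hz, e⟩
          refine ⟨j, z, ?_, e⟩
          rcases eq_or_ne j i with rfl | hj
          · rw [hi, ho]
            exact Finset.mem_insert_of_mem hz
          · rwa [hne j hj]
        · rintro ⟨j, z, hz, e⟩
          refine ⟨j, z, ?_, e⟩
          rcases eq_or_ne j i with rfl | hj
          · rw [hi, ho, Finset.mem_insert] at hz
            rcases hz with rfl | hz
            · exact absurd e.symm hy
            · exact hz
          · rwa [hne j hj] at hz
    · rcases eq_or_ne j i with rfl | hji
      · rw [hi, ho, Finset.card_insert_of_notMem hxn]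
        refine ⟨fun y hy => ?_, fun _ => ⟨x, Finset.mem_insert_self _ _, ?_⟩⟩
        · rcases Finset.mem_insert.1 hy with rfl | hy
          · simp [applyWrite]
          · simp only [applyWrite, Function.update_of_ne (hfree j y hy)]
            exact (h.tag_le j hc y hy).trans (Nat.le_succ _)
        · simp [applyWrite]
      · rw [hne j hji] at hj ⊢
        have hsame : ∀ y ∈ (loc j).owned,
            applyWrite (f i) mem (some (x, (loc i).owned.card + 1)) (f j y) =
              mem (f j y) := fun y hy => Function.update_of_ne (hfree j y hy) _ _
        refine ⟨fun y hy => (hsame y hy).trans_le (h.tag_le j hj y hy), fun hn => ?_⟩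
        obtain ⟨y, hy, e⟩ := h.exists_tag j hj hn
        exact ⟨y, hy, (hsame y hy).trans e⟩
  · have hsub : ∀ j, (Function.update loc i l' j).owned ⊆ (loc j).owned := by
      intro j
      rcases eq_or_ne j i with rfl | hj
      · rw [hi, ho]
        exact Finset.erase_subset _ _
      · rw [hne j hj]
    refine ⟨fun j k y z hy hz e => h.disjoint j k y z (hsub j hy) (hsub k hz) e, fun y => ?_,
      fun j hj => ?_⟩
    · rcases eq_or_ne y (f i x) with rfl | hy
      · simp only [applyWrite, Function.update_self, ne_eq, not_true_eq_false, false_iff]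
        rintro ⟨j, z, hz, e⟩
        have := h.disjoint j i z x (hsub j hz) hx e
        subst this
        rw [hi, ho, (f j).injective e] at hz
        simp at hz
      · simp only [applyWrite, Function.update_of_ne hy]
        refine (h.ne_zero_iff y).trans ⟨?_, fun ⟨j, z, hz, e⟩ => ⟨j, z, hsub j hz, e⟩⟩
        rintro ⟨j, z, hz, e⟩
        refine ⟨j, z, ?_, e⟩
        rcases eq_or_ne j i with rfl | hj
        · rw [hi, ho]
          exact Finset.mem_erase.2 ⟨fun hzx => hy (by rw [← e, hzx]), hz⟩
        · rwa [hne j hj]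
    · rcases eq_or_ne j i with rfl | hji
      · rw [hi] at hj
        exact absurd hj hc
      · rw [hne j hji] at hj ⊢
        have hsame : ∀ y ∈ (loc j).owned,
            applyWrite (f i) mem (some (x, 0)) (f j y) = mem (f j y) := fun y hy =>
          Function.update_of_ne (fun e => hji (h.disjoint j i y x hy hx e)) _ _
        refine ⟨fun y hy => (hsame y hy).trans_le (h.tag_le j hj y hy), fun hn => ?_⟩
        obtain ⟨y, hy, e⟩ := h.exists_tag j hj hn
        exact ⟨y, hy, (hsame y hy).trans e⟩

/-- A run of the race algorithm from some configuration that satisfies the invariants, with address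
permutations `f` and schedule `σ`, given by the
memory, the phases and the local states at each time. -/
structure RaceRun {m n : ℕ} [NeZero m] (f : Fin n → Equiv.Perm (Fin m)) (σ : ℕ → Option (Fin n))
    (mem : ℕ → Fin m → ℕ) (phase : ℕ → Fin n → Phase) (loc : ℕ → Fin n → Loc m) : Prop where
  inv : ∀ t, Inv f (mem t) (phase t) (loc t)
  idle : ∀ t, σ t = none → mem (t + 1) = mem t ∧ phase (t + 1) = phase t ∧ loc (t + 1) = loc t
  step : ∀ t i, σ t = some i →
    ∃ p' l' w, Move (fun x => mem t (f i x)) (phase t i) (loc t i) p' l' w ∧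
      mem (t + 1) = applyWrite (f i) (mem t) w ∧
      phase (t + 1) = Function.update (phase t) i p' ∧ loc (t + 1) = Function.update (loc t) i l'

lemma raceRun_run {m n : ℕ} [NeZero m] (f : Fin n → Equiv.Perm (Fin m))
    (σ : ℕ → Option (Fin n)) :
    RaceRun f σ (fun t => (run (race m) f σ t).mem) (fun t => (run (race m) f σ t).phase)
      (fun t => (run (race m) f σ t).loc) := by
  have hstep : ∀ t i, σ t = some i → Inv f (run (race m) f σ t).mem (run (race m) f σ t).phase
      (run (race m) f σ t).loc →
    ∃ p' l' w, Move (fun x => (run (race m) f σ t).mem (f i x)) ((run (race m) f σ t).phase i)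
        ((run (race m) f σ t).loc i) p' l' w ∧
      run (race m) f σ (t + 1) = {
        mem := applyWrite (f i) (run (race m) f σ t).mem w
        phase := Function.update (run (race m) f σ t).phase i p'
        loc := Function.update (run (race m) f σ t).loc i l' } := by
    intro t i hi hinv
    obtain ⟨p', l', w, hmove, heq⟩ := exists_move f (run (race m) f σ t) i (hinv.releasing i)
    exact ⟨p', l', w, hmove, by simp only [run, hi, heq]⟩
  have hidle : ∀ t, σ t = none → run (race m) f σ (t + 1) = run (race m) f σ t := by
    intro t ht
    simp only [run, ht]
  have hinv : ∀ t, Inv f (run (race m) f σ t).mem (run (race m) f σ t).phase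
      (run (race m) f σ t).loc := by
    intro t
    induction t with
    | zero => exact Inv.initial f
    | succ t ih =>
      cases hi : σ t with
      | none => rw [hidle t hi]; exact ih
      | some i =>
        obtain ⟨p', l', w, hmove, heq⟩ := hstep t i hi ih
        rw [heq]
        exact ih.step i hmove
  refine ⟨hinv, fun t ht => ?_, fun t i hi => ?_⟩
  · have heq := hidle t ht
    exact ⟨congrArg Config.mem heq, congrArg Config.phase heq, congrArg Config.loc heq⟩
  · obtain ⟨p', l', w, hmove, heq⟩ := hstep t i hi (hinv t)
    exact ⟨p', l', w, hmove, congrArg Config.mem heq, congrArg Config.phase heq,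
      congrArg Config.loc heq⟩

/-- Two processes in the critical section would both own all the registers. -/
theorem race_mutualExclusion (m n : ℕ) [NeZero m] : (race m).MutualExclusion n := by
  intro f σ t i j hi hj
  have h := (raceRun_run f σ).inv t
  refine h.disjoint i j ((f i).symm 0) ((f j).symm 0) ?_ ?_ (by simp)
  · rw [h.critical i hi]
    exact Finset.mem_univ _
  · rw [h.critical j hj]
    exact Finset.mem_univ _

/-! ### Runs of the race algorithm -/

section Inversion

variable {m : ℕ} [NeZero m] {μ : Fin m → ℕ} {p p' : Phase} {l' : Loc m} {w : Option (Fin m × ℕ)}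
  {S Q W : Finset (Fin m)}

lemma Move.of_wait (h : Move μ .trying (.wait W) p' l' w) :
    p' = .trying ∧ (W = ∅ ∧ l' = .scan ∅ Finset.univ ∨
      W.Nonempty ∧ μ (pick W) = 0 ∧ l' = .wait (W.erase (pick W)) ∨
      W.Nonempty ∧ μ (pick W) ≠ 0 ∧ l' = .wait W) := by
  cases h <;> simp_all

lemma Move.of_scan (h : Move μ .trying (.scan S Q) p' l' w) :
    S = Finset.univ ∧ p' = .critical ∧ l' = .drop Finset.univ ∨
    S ≠ Finset.univ ∧ p' = .trying ∧ (Q = ∅ ∧ l' = .scan S Finset.univ ∨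
      Q.Nonempty ∧ μ (pick Q) = 0 ∧ l' = .scan (insert (pick Q) S) (Q.erase (pick Q)) ∨
      Q.Nonempty ∧ μ (pick Q) ≠ 0 ∧ l' = .look S Q) := by
  cases h <;> simp_all

lemma Move.of_look (h : Move μ .trying (.look S Q) p' l' w) :
    p' = .trying ∧ (S.card < μ (pick Q) ∧ l' = .drop S ∨
      μ (pick Q) ≤ S.card ∧ l' = .scan S (Q.erase (pick Q))) := by
  cases h <;> simp_all

lemma Move.of_drop (h : Move μ p (.drop S) p' l' w) (hp : p = .trying ∨ p = .releasing) :
    S.Nonempty ∧ p' = p ∧ l' = .drop (S.erase (pick S)) ∨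
    S = ∅ ∧ l' = .wait Finset.univ ∧ (p = .releasing → p' = .remainder) := by
  cases h <;> simp_all

lemma Move.of_remainder {l : Loc m} (h : Move μ .remainder l p' l' w) : l' = l := by
  cases h <;> simp_all

end Inversion

namespace RaceRun

variable {m n : ℕ} [NeZero m] {f : Fin n → Equiv.Perm (Fin m)} {σ : ℕ → Option (Fin n)}
  {mem : ℕ → Fin m → ℕ} {phase : ℕ → Fin n → Phase} {loc : ℕ → Fin n → Loc m}

lemma move (h : RaceRun f σ mem phase loc) {t : ℕ} {i : Fin n} (ht : σ t = some i) :
    ∃ w, Move (fun x => mem t (f i x)) (phase t i) (loc t i) (phase (t + 1) i) (loc (t + 1) i) w ∧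
      mem (t + 1) = applyWrite (f i) (mem t) w := by
  obtain ⟨p', l', w, hm, h1, h2, h3⟩ := h.step t i ht
  exact ⟨w, by simpa [h2, h3] using hm, h1⟩

lemma unchanged (h : RaceRun f σ mem phase loc) {t : ℕ} {i : Fin n} (ht : σ t ≠ some i) :
    phase (t + 1) i = phase t i ∧ loc (t + 1) i = loc t i := by
  cases hs : σ t with
  | none => simp [h.idle t hs]
  | some j =>
    obtain ⟨p', l', w, -, -, h2, h3⟩ := h.step t j hs
    have hij : i ≠ j := fun e => ht (by rw [hs, e])
    simp [h2, h3, hij]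

lemma phase_of_contending (h : RaceRun f σ mem phase loc) {t : ℕ} {i : Fin n}
    (hc : (loc t i).Contending) : phase t i = .trying := by
  cases hp : phase t i with
  | trying => rfl
  | remainder => rw [(h.inv t).remainder i hp] at hc; exact hc.elim
  | critical => rw [(h.inv t).critical i hp] at hc; exact hc.elim
  | releasing =>
    obtain ⟨S, hS⟩ := (h.inv t).releasing i hp
    rw [hS] at hc; exact hc.elim

lemma ne_zero_of_owned (h : RaceRun f σ mem phase loc) {t : ℕ} {i : Fin n} {x : Fin m}
    (hx : x ∈ (loc t i).owned) : mem t (f i x) ≠ 0 :=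
  ((h.inv t).ne_zero_iff _).2 ⟨i, x, hx, rfl⟩

/-- The registers that a process owns can be changed only by giving them back. -/
lemma mem_eq_of_owned (h : RaceRun f σ mem phase loc) {t : ℕ} {i : Fin n} {x : Fin m}
    (hx : x ∈ (loc t i).owned) (hx' : x ∈ (loc (t + 1) i).owned) :
    mem (t + 1) (f i x) = mem t (f i x) := by
  cases hs : σ t with
  | none => simp [h.idle t hs]
  | some j =>
    obtain ⟨w, hmove, hmem⟩ := h.move hs
    rw [hmem]
    rcases hmove.effect with ⟨rfl, -⟩ | ⟨y, rfl, hy, -⟩ | ⟨y, hy, rfl, ho, -⟩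
    · rfl
    · refine Function.update_of_ne (fun e => h.ne_zero_of_owned hx ?_) _ _
      rw [e]
      exact hy
    · refine Function.update_of_ne (fun e => ?_) _ _
      have := (h.inv t).disjoint i j x y hx hy e
      subst this
      rw [ho, (f i).injective e] at hx'
      simp at hx'

lemma owned_subset_of_not_contending (h : RaceRun f σ mem phase loc) {t : ℕ} {i : Fin n}
    (hc : ¬ (loc (t + 1) i).Contending) : (loc (t + 1) i).owned ⊆ (loc t i).owned := by
  by_cases ht : σ t = some i
  · obtain ⟨w, hmove, -⟩ := h.move ht
    rcases hmove.effect with ⟨-, ho, -⟩ | ⟨y, -, -, -, -, hc'⟩ | ⟨y, -, -, ho, -⟩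
    · rw [ho]
    · exact absurd hc' hc
    · rw [ho]
      exact Finset.erase_subset _ _
  · rw [(h.unchanged ht).2]

/-- A process with a pending operation or in the critical section eventually takes a step, and
its local state is unchanged until then. -/
lemma exists_next_step (h : RaceRun f σ mem phase loc)
    (hfair : ∀ i t, phase t i ≠ .remainder → ∃ t' ≥ t, σ t' = some i) {t : ℕ} {i : Fin n}
    (hp : phase t i ≠ .remainder) :
    ∃ t' ≥ t, σ t' = some i ∧ phase t' i = phase t i ∧ loc t' i = loc t i := by
  classical
  have hex : ∃ k, σ (t + k) = some i := by
    obtain ⟨t', ht', hs⟩ := hfair i t hp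
    exact ⟨t' - t, by rwa [Nat.add_sub_cancel' ht']⟩
  have hmin : ∀ k ≤ Nat.find hex, phase (t + k) i = phase t i ∧ loc (t + k) i = loc t i := by
    intro k
    induction k with
    | zero => simp
    | succ k ih =>
      intro hk
      have h1 := ih (by omega)
      have h2 := h.unchanged (t := t + k) (i := i) (Nat.find_min hex (by omega))
      exact ⟨h2.1.trans h1.1, h2.2.trans h1.2⟩
  exact ⟨t + Nat.find hex, by omega, Nat.find_spec hex, hmin _ le_rfl⟩

/-- A process that gives back its registers finishes doing so. -/
lemma exists_drop_end (h : RaceRun f σ mem phase loc)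
    (hfair : ∀ i t, phase t i ≠ .remainder → ∃ t' ≥ t, σ t' = some i) {t : ℕ} {i : Fin n}
    {S : Finset (Fin m)} (hp : phase t i = .trying ∨ phase t i = .releasing)
    (hl : loc t i = .drop S) :
    ∃ t' > t, loc t' i = .wait Finset.univ ∧
      (phase t i = .releasing → phase t' i = .remainder) := by
  induction hk : S.card generalizing t S with
  | zero =>
    obtain ⟨t', ht', hs, hp', hl'⟩ := h.exists_next_step hfair (t := t) (i := i)
      (by rcases hp with hp | hp <;> simp [hp])
    obtain ⟨w, hmove, -⟩ := h.move hs
    rw [hp', hl', hl] at hmove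
    rcases hmove.of_drop hp with ⟨hS, -⟩ | ⟨-, h1, h2⟩
    · rw [Finset.card_eq_zero.1 hk] at hS
      simp at hS
    · exact ⟨t' + 1, by omega, h1, h2⟩
  | succ k ih =>
    obtain ⟨t', ht', hs, hp', hl'⟩ := h.exists_next_step hfair (t := t) (i := i)
      (by rcases hp with hp | hp <;> simp [hp])
    obtain ⟨w, hmove, -⟩ := h.move hs
    rw [hp', hl', hl] at hmove
    rcases hmove.of_drop hp with ⟨hS, h1, h2⟩ | ⟨rfl, -⟩
    · obtain ⟨t'', ht'', h3, h4⟩ := ih (t := t' + 1) (by rwa [h1]) h2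
        (by rw [Finset.card_erase_of_mem (pick_mem hS), hk]; rfl)
      exact ⟨t'', by omega, h3, by rwa [h1] at h4⟩
    · simp at hk

/-- A process that contends forever tries again and again to capture each register. -/
lemma exists_visit (h : RaceRun f σ mem phase loc)
    (hfair : ∀ i t, phase t i ≠ .remainder → ∃ t' ≥ t, σ t' = some i) {T : ℕ} {i : Fin n}
    (hc : ∀ t ≥ T, (loc t i).Contending) (x : Fin m) :
    ∃ t ≥ T, σ t = some i ∧ ∃ S Q, loc t i = .scan S Q ∧ S ≠ Finset.univ ∧ Q.Nonempty ∧
      pick Q = x := by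
  -- `a Q` bounds the number of register accesses before `x` has its turn, where `Q` is the rest
  -- of the current scan.
  set a : Finset (Fin m) → ℕ := fun Q => Q.card + if x ∈ Q then 0 else m + 1 with ha
  have ha_erase : ∀ Q : Finset (Fin m), Q.Nonempty → pick Q ≠ x → a (Q.erase (pick Q)) < a Q := by
    intro Q hQ hx
    have := Finset.card_erase_lt_of_mem (pick_mem hQ)
    simp only [ha, Finset.mem_erase, hx.symm, ne_eq, not_false_eq_true, true_and]
    omega
  have key : ∀ N : ℕ, ∀ t ≥ T, ∀ S Q, (loc t i = .scan S Q ∧ 2 * a Q < N) ∨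
      (loc t i = .look S Q ∧ 2 * a (Q.erase (pick Q)) + 1 < N) →
      ∃ t ≥ T, σ t = some i ∧ ∃ S Q, loc t i = .scan S Q ∧ S ≠ Finset.univ ∧ Q.Nonempty ∧
        pick Q = x := by
    intro N
    induction N with
    | zero => intro t _ S Q hcase; omega
    | succ N ih =>
      intro t ht S Q hcase
      have hp := h.phase_of_contending (hc t ht)
      obtain ⟨t', ht', hs, hp', hl'⟩ := h.exists_next_step hfair (t := t) (i := i) (by simp [hp])
      obtain ⟨w, hmove, -⟩ := h.move hs
      have hc' := hc (t' + 1) (by omega)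
      rw [hp', hl', hp] at hmove
      rcases hcase with ⟨hl, hN⟩ | ⟨hl, hN⟩
      · rw [hl] at hmove
        rcases hmove.of_scan with ⟨-, -, h1⟩ | ⟨hS, -, h1⟩
        · rw [h1] at hc'
          exact hc'.elim
        · by_cases hx : Q.Nonempty ∧ pick Q = x
          · exact ⟨t', by omega, hs, S, Q, hl'.trans hl, hS, hx⟩
          · rcases h1 with ⟨rfl, h1⟩ | ⟨hQ, -, h1⟩ | ⟨hQ, -, h1⟩
            · refine ih (t' + 1) (by omega) _ _ (Or.inl ⟨h1, ?_⟩)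
              simp only [ha, Finset.card_empty, Finset.notMem_empty, if_false, Finset.card_univ,
                Fintype.card_fin, Finset.mem_univ, if_true] at hN ⊢
              omega
            · have := ha_erase Q hQ fun e => hx ⟨hQ, e⟩
              exact ih (t' + 1) (by omega) _ _ (Or.inl ⟨h1, by omega⟩)
            · have := ha_erase Q hQ fun e => hx ⟨hQ, e⟩
              exact ih (t' + 1) (by omega) _ _ (Or.inr ⟨h1, by omega⟩)
      · rw [hl] at hmove
        rcases hmove.of_look.2 with ⟨-, h1⟩ | ⟨-, h1⟩
        · rw [h1] at hc'
          exact hc'.elim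
        · exact ih (t' + 1) (by omega) _ _ (Or.inl ⟨h1, by omega⟩)
  have hT := hc T le_rfl
  cases hl : loc T i with
  | wait W => rw [hl] at hT; exact hT.elim
  | drop S => rw [hl] at hT; exact hT.elim
  | scan S Q => exact key _ T le_rfl S Q (Or.inl ⟨hl, Nat.lt_succ_self _⟩)
  | look S Q => exact key _ T le_rfl S Q (Or.inr ⟨hl, Nat.lt_succ_self _⟩)

/-! ### Deadlock-freedom -/

/-- If from some time on no contending process owns more than `K` registers, then eventually no tag
exceeds `K`: the processes that are giving back registers at that time finish doing so. -/
lemma eventually_mem_le (h : RaceRun f σ mem phase loc)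
    (hfair : ∀ i t, phase t i ≠ .remainder → ∃ t' ≥ t, σ t' = some i) {T K : ℕ}
    (hnc : ∀ t ≥ T, ∀ i, phase t i ≠ .critical)
    (hK : ∀ t ≥ T, ∀ i, (loc t i).Contending → (loc t i).owned.card ≤ K) :
    ∃ T' ≥ T, ∀ t ≥ T', ∀ y, mem t y ≤ K := by
  have hcont : ∀ t ≥ T, ∀ i, (loc t i).Contending → ∀ x ∈ (loc t i).owned, mem t (f i x) ≤ K :=
    fun t ht i hc x hx => ((h.inv t).tag_le i hc x hx).trans (hK t ht i hc)
  have hi : ∀ i, ∃ T' ≥ T, ∀ t ≥ T', ∀ x ∈ (loc t i).owned, mem t (f i x) ≤ K := by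
    intro i
    have hstart : ∃ T' ≥ T, ∀ x ∈ (loc T' i).owned, mem T' (f i x) ≤ K := by
      cases hl : loc T i with
      | wait W => exact ⟨T, le_rfl, by simp [hl, Loc.owned]⟩
      | scan S Q => exact ⟨T, le_rfl, hcont T le_rfl i (by rw [hl]; trivial)⟩
      | look S Q => exact ⟨T, le_rfl, hcont T le_rfl i (by rw [hl]; trivial)⟩
      | drop S =>
        have hp : phase T i = .trying ∨ phase T i = .releasing := by
          cases hp : phase T i with
          | trying => simp
          | releasing => simp
          | critical => exact absurd hp (hnc T le_rfl i)
          | remainder => simp [(h.inv T).remainder i hp] at hl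
        obtain ⟨t', ht', hl', -⟩ := h.exists_drop_end hfair hp hl
        exact ⟨t', ht'.le, by simp [hl', Loc.owned]⟩
    obtain ⟨T', hT', hb⟩ := hstart
    refine ⟨T', hT', fun t ht => ?_⟩
    induction t, ht using Nat.le_induction with
    | base => exact hb
    | succ t ht ih =>
      intro x hx
      by_cases hc : (loc (t + 1) i).Contending
      · exact hcont _ (by omega) i hc x hx
      · have hx' := h.owned_subset_of_not_contending hc hx
        rw [h.mem_eq_of_owned hx' hx]
        exact ih x hx'
  choose T' hT' hb using hi
  refine ⟨T + ∑ i, T' i, by omega, fun t ht y => ?_⟩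
  by_contra hy
  obtain ⟨i, x, hx, rfl⟩ := ((h.inv t).ne_zero_iff y).1 (by omega)
  have : T' i ≤ ∑ i, T' i := Finset.single_le_sum (fun _ _ => Nat.zero_le _) (Finset.mem_univ i)
  exact hy (hb i t (by omega) x hx)

/-- A period in which no process is in the critical section, no contending process owns more than
`K` registers and no tag exceeds `K`. -/
structure Bounded (mem : ℕ → Fin m → ℕ) (phase : ℕ → Fin n → Phase) (loc : ℕ → Fin n → Loc m)
    (T K : ℕ) : Prop where
  not_critical : ∀ t ≥ T, ∀ i, phase t i ≠ .critical
  card_le : ∀ t ≥ T, ∀ i, (loc t i).Contending → (loc t i).owned.card ≤ K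
  mem_le : ∀ t ≥ T, ∀ y, mem t y ≤ K

/-- A contending process that owns `K` registers keeps contending with the same registers. -/
lemma leader_succ (h : RaceRun f σ mem phase loc) {T K : ℕ} (hb : Bounded mem phase loc T K)
    {t : ℕ} (ht : T ≤ t) {i : Fin n} (hc : (loc t i).Contending)
    (hK : (loc t i).owned.card = K) :
    (loc (t + 1) i).Contending ∧ (loc (t + 1) i).owned = (loc t i).owned := by
  by_cases hs : σ t = some i
  · obtain ⟨w, hmove, -⟩ := h.move hs
    rw [h.phase_of_contending hc] at hmove
    have hcard := hb.card_le (t + 1) (by omega) i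
    cases hl : loc t i with
    | wait W => rw [hl] at hc; exact hc.elim
    | drop S => rw [hl] at hc; exact hc.elim
    | look S Q =>
      rw [hl] at hmove hK
      rcases hmove.of_look.2 with ⟨h1, -⟩ | ⟨-, h1⟩
      · exact absurd (h1.trans_le (hb.mem_le t ht _)) (by simp [← hK, Loc.owned])
      · rw [h1]
        exact ⟨trivial, rfl⟩
    | scan S Q =>
      rw [hl] at hmove hK
      rcases hmove.of_scan with ⟨-, h1, -⟩ | ⟨-, -, ⟨-, h1⟩ | ⟨-, h0, h1⟩ | ⟨-, -, h1⟩⟩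
      · exact absurd h1 (hb.not_critical (t + 1) (by omega) i)
      · rw [h1]
        exact ⟨trivial, rfl⟩
      · have hn : pick Q ∉ S := fun hx =>
          h.ne_zero_of_owned (t := t) (i := i) (by rw [hl]; exact hx) h0
        rw [h1] at hcard
        have := hcard trivial
        rw [Loc.owned, Finset.card_insert_of_notMem hn, ← hK] at this
        simp [Loc.owned] at this
      · rw [h1]
        exact ⟨trivial, rfl⟩
  · rw [(h.unchanged hs).2]
    exact ⟨hc, rfl⟩

lemma leader_forever (h : RaceRun f σ mem phase loc) {T K : ℕ} (hb : Bounded mem phase loc T K)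
    {T' : ℕ} (hT : T ≤ T') {i : Fin n} (hc : (loc T' i).Contending)
    (hK : (loc T' i).owned.card = K) :
    ∀ t ≥ T', (loc t i).Contending ∧ (loc t i).owned = (loc T' i).owned := by
  intro t ht
  induction t, ht using Nat.le_induction with
  | base => exact ⟨hc, rfl⟩
  | succ t ht ih =>
    have := h.leader_succ hb (hT.trans ht) ih.1 (by rw [ih.2, hK])
    exact ⟨this.1, this.2.trans ih.2⟩

/-- A leader, that is, a contending process that owns `K` registers, cannot find a free register,
as it would capture it. -/
lemma exists_ne_zero_of_leader (h : RaceRun f σ mem phase loc)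
    (hfair : ∀ i t, phase t i ≠ .remainder → ∃ t' ≥ t, σ t' = some i) {T K : ℕ}
    (hb : Bounded mem phase loc T K) {T' : ℕ} (hT : T ≤ T') {i : Fin n}
    (hc : (loc T' i).Contending) (hK : (loc T' i).owned.card = K) (y : Fin m) :
    ∃ t ≥ T', mem t y ≠ 0 := by
  have hlead := h.leader_forever hb hT hc hK
  obtain ⟨t, ht, hs, S, Q, hl, hS, hQ, hx⟩ :=
    h.exists_visit hfair (fun t ht => (hlead t ht).1) ((f i).symm y)
  refine ⟨t, ht, fun h0 => ?_⟩
  obtain ⟨w, hmove, -⟩ := h.move hs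
  rw [h.phase_of_contending (hlead t ht).1, hl] at hmove
  have hμ : mem t (f i (pick Q)) = 0 := by rw [hx, Equiv.apply_symm_apply, h0]
  rcases hmove.of_scan with ⟨h1, -⟩ | ⟨-, -, ⟨h1, -⟩ | ⟨-, -, h1⟩ | ⟨-, h1, -⟩⟩
  · exact hS h1
  · exact hQ.ne_empty h1
  · have h2 : pick Q ∈ (loc t i).owned := by
      rw [(hlead t ht).2, ← (hlead (t + 1) (by omega)).2, h1]
      exact Finset.mem_insert_self _ _
    exact h.ne_zero_of_owned h2 hμ
  · exact h1 hμ

/-- If no process is in the critical section and a process is trying to enter it, the registers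
cannot remain free forever. -/
lemma bound_pos (h : RaceRun f σ mem phase loc)
    (hfair : ∀ i t, phase t i ≠ .remainder → ∃ t' ≥ t, σ t' = some i) {T K : ℕ}
    (hb : Bounded mem phase loc T K) {i : Fin n} (hp : ∀ t ≥ T, phase t i = .trying) : 0 < K := by
  rw [Nat.pos_iff_ne_zero]
  rintro rfl
  have hfree : ∀ t ≥ T, ∀ y, mem t y = 0 := fun t ht y => Nat.le_zero.1 (hb.mem_le t ht y)
  have hnot : ∀ t ≥ T, ¬ (loc t i).Contending := by
    intro t ht hc
    obtain ⟨t', ht', h1⟩ := h.exists_ne_zero_of_leader hfair hb ht hc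
      (Nat.le_zero.1 (hb.card_le t ht i hc)) 0
    exact h1 (hfree t' (by omega) 0)
  have hwait : ∀ k : ℕ, ∀ t ≥ T, ∀ W, loc t i = .wait W → W.card ≠ k := by
    intro k
    induction k using Nat.strong_induction_on with
    | _ k ih =>
      rintro t ht W hl rfl
      obtain ⟨t', ht', hs, hp', hl'⟩ := h.exists_next_step hfair (t := t) (i := i)
        (by simp [hp t ht])
      obtain ⟨w, hmove, -⟩ := h.move hs
      rw [hp t' (by omega), hl', hl] at hmove
      rcases hmove.of_wait.2 with ⟨-, h1⟩ | ⟨hW, -, h1⟩ | ⟨-, h1, -⟩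
      · exact hnot (t' + 1) (by omega) (by rw [h1]; trivial)
      · exact ih _ (Finset.card_erase_lt_of_mem (pick_mem hW)) (t' + 1) (by omega) _ h1 rfl
      · exact h1 (hfree t' (by omega) _)
  cases hl : loc T i with
  | wait W => exact hwait _ T le_rfl W hl rfl
  | scan S Q => exact hnot T le_rfl (by rw [hl]; trivial)
  | look S Q => exact hnot T le_rfl (by rw [hl]; trivial)
  | drop S =>
    obtain ⟨t', ht', hl', -⟩ := h.exists_drop_end hfair (Or.inl (hp T le_rfl)) hl
    exact hwait _ t' ht'.le _ hl' rfl

/-- If some register `y` holds the tag `K` forever, each process eventually waits forever or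
contends with `K` registers forever: a process that contends with fewer registers reads `y` and
withdraws, and does not pass `y` while it waits. -/
lemma eventually_wait_or_leader (h : RaceRun f σ mem phase loc)
    (hfair : ∀ i t, phase t i ≠ .remainder → ∃ t' ≥ t, σ t' = some i) {T K : ℕ}
    (hb : Bounded mem phase loc T K) (hK : 0 < K) {y : Fin m} (hy : ∀ t ≥ T, mem t y = K)
    (i : Fin n) :
    ∃ T' ≥ T, ∀ t ≥ T', (∃ W, loc t i = .wait W) ∨
      (loc t i).Contending ∧ (loc t i).owned.card = K := by
  by_cases hwait : ∀ t ≥ T, ∃ W, loc t i = .wait W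
  · exact ⟨T, le_rfl, fun t ht => Or.inl (hwait t ht)⟩
  push Not at hwait
  obtain ⟨t₀, ht₀, hl₀⟩ := hwait
  set x := (f i).symm y with hx
  have hfx : ∀ t ≥ T, mem t (f i x) = K := by simpa [hx] using hy
  -- Once `H` holds, it holds forever: the process cannot see `y` free, so it does not stop waiting.
  set H : ℕ → Prop := fun t => (∃ W, loc t i = .wait W ∧ x ∈ W) ∨
    (loc t i).Contending ∧ (loc t i).owned.card = K with hH
  suffices hex : ∃ T' ≥ T, H T' by
    obtain ⟨T', hT', hHT⟩ := hex
    have hall : ∀ t ≥ T', H t := by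
      intro t ht
      induction t, ht using Nat.le_induction with
      | base => exact hHT
      | succ t ht ih =>
        rcases ih with ⟨W, hl, hxW⟩ | ⟨hc, hcard⟩
        · by_cases hs : σ t = some i
          · obtain ⟨w, hmove, -⟩ := h.move hs
            rw [hl] at hmove
            cases hp : phase t i with
            | remainder =>
              rw [hp] at hmove
              exact Or.inl ⟨W, hmove.of_remainder, hxW⟩
            | critical => exact absurd hp (hb.not_critical t (by omega) i)
            | releasing =>
              obtain ⟨S, hS⟩ := (h.inv t).releasing i hp
              rw [hS] at hl
              cases hl
            | trying =>
              rw [hp] at hmove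
              rcases hmove.of_wait.2 with ⟨h1, -⟩ | ⟨-, h0, h1⟩ | ⟨-, -, h1⟩
              · simp [h1] at hxW
              · refine Or.inl ⟨_, h1, Finset.mem_erase.2 ⟨fun e => ?_, hxW⟩⟩
                rw [← e, hfx t (by omega)] at h0
                omega
              · exact Or.inl ⟨W, h1, hxW⟩
          · exact Or.inl ⟨W, (h.unchanged hs).2.trans hl, hxW⟩
        · have := h.leader_succ hb (by omega) hc hcard
          exact Or.inr ⟨this.1, by rw [this.2, hcard]⟩
    refine ⟨T', hT', fun t ht => ?_⟩
    rcases hall t ht with ⟨W, hl, -⟩ | hlead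
    · exact Or.inl ⟨W, hl⟩
    · exact Or.inr hlead
  by_contra hno
  push Not at hno
  have hdrop : ∀ t ≥ T, ∀ S, loc t i ≠ .drop S := by
    intro t ht S hl
    have hp : phase t i = .trying ∨ phase t i = .releasing := by
      cases hp : phase t i with
      | trying => simp
      | releasing => simp
      | critical => exact absurd hp (hb.not_critical t ht i)
      | remainder => simp [(h.inv t).remainder i hp] at hl
    obtain ⟨t', ht', hl', -⟩ := h.exists_drop_end hfair hp hl
    exact hno t' (by omega) (Or.inl ⟨_, hl', Finset.mem_univ _⟩)
  have hcont : ∀ t ≥ t₀, (loc t i).Contending := by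
    intro t ht
    induction t, ht using Nat.le_induction with
    | base =>
      cases hl : loc t₀ i with
      | wait W => exact absurd hl (hl₀ W)
      | drop S => exact absurd hl (hdrop t₀ ht₀ S)
      | scan S Q => trivial
      | look S Q => trivial
    | succ t ht ih =>
      by_cases hs : σ t = some i
      · obtain ⟨w, hmove, -⟩ := h.move hs
        rw [h.phase_of_contending ih] at hmove
        have hd := hdrop (t + 1) (by omega)
        cases hl : loc t i with
        | wait W => rw [hl] at ih; exact ih.elim
        | drop S => rw [hl] at ih; exact ih.elim
        | look S Q =>
          rw [hl] at hmove
          rcases hmove.of_look.2 with ⟨-, h1⟩ | ⟨-, h1⟩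
          · exact absurd h1 (hd _)
          · rw [h1]
            trivial
        | scan S Q =>
          rw [hl] at hmove
          rcases hmove.of_scan with ⟨-, -, h1⟩ | ⟨-, -, ⟨-, h1⟩ | ⟨-, -, h1⟩ | ⟨-, -, h1⟩⟩
          · exact absurd h1 (hd _)
          all_goals rw [h1]; trivial
      · rwa [(h.unchanged hs).2]
  obtain ⟨t, ht, hs, S, Q, hl, hS, hQ, hpick⟩ := h.exists_visit hfair hcont x
  obtain ⟨w, hmove, -⟩ := h.move hs
  rw [h.phase_of_contending (hcont t ht), hl] at hmove
  have hlook : loc (t + 1) i = .look S Q := by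
    rcases hmove.of_scan with ⟨h1, -⟩ | ⟨-, -, ⟨h1, -⟩ | ⟨-, h0, -⟩ | ⟨-, -, h1⟩⟩
    · exact absurd h1 hS
    · exact absurd h1 hQ.ne_empty
    · rw [hpick, hfx t (by omega)] at h0
      omega
    · exact h1
  have hp := h.phase_of_contending (hcont (t + 1) (by omega))
  obtain ⟨t', ht', hs', hp', hl'⟩ := h.exists_next_step hfair (t := t + 1) (i := i) (by simp [hp])
  obtain ⟨w', hmove', -⟩ := h.move hs'
  rw [hp', hl', hp, hlook] at hmove'
  rcases hmove'.of_look.2 with ⟨-, h1⟩ | ⟨h1, -⟩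
  · exact hdrop (t' + 1) (by omega) _ h1
  · rw [hpick, hfx t' (by omega)] at h1
    have hcard := hb.card_le (t + 1) (by omega) i (hcont _ (by omega))
    refine hno (t + 1) (by omega) (Or.inr ⟨hcont _ (by omega), ?_⟩)
    rw [hlook] at hcard ⊢
    exact le_antisymm hcard h1

/-- If every register is owned and the owners contend with `K` registers each, then the number of
owners is at most `n` and divides `m ∈ M n`. So there is one owner, and it owns everything. -/
lemma eq_of_all_owned (h : RaceRun f σ mem phase loc) (hM : m ∈ M n) {t K : ℕ} (q : Fin n)
    (hq : (loc t q).Contending) (hall : ∀ y, mem t y ≠ 0)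
    (hK : ∀ i, (∃ W, loc t i = .wait W) ∨ (loc t i).Contending ∧ (loc t i).owned.card = K) :
    K = m := by
  classical
  set P : Finset (Fin n) := Finset.univ.filter fun i => (loc t i).Contending with hP
  have hcard : m = P.card * K := by
    have hunion : (Finset.univ : Finset (Fin m)) =
        P.biUnion fun i => (loc t i).owned.map (f i).toEmbedding := by
      ext y
      simp only [Finset.mem_univ, Finset.mem_biUnion, Finset.mem_map, true_iff]
      obtain ⟨i, x, hx, e⟩ := ((h.inv t).ne_zero_iff y).1 (hall y)
      refine ⟨i, ?_, x, hx, e⟩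
      rcases hK i with ⟨W, hl⟩ | ⟨hc, -⟩
      · simp [hl, Loc.owned] at hx
      · simpa [hP] using hc
    calc m = (Finset.univ : Finset (Fin m)).card := by simp
      _ = ∑ i ∈ P, ((loc t i).owned.map (f i).toEmbedding).card := by
        rw [hunion, Finset.card_biUnion]
        intro i _ j _ hij
        rw [Function.onFun, Finset.disjoint_left]
        simp only [Finset.mem_map, Equiv.coe_toEmbedding, not_exists, not_and,
          forall_exists_index, and_imp]
        rintro y x hx rfl z hz e
        exact hij ((h.inv t).disjoint i j x z hx hz e.symm)
      _ = ∑ i ∈ P, K := by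
        refine Finset.sum_congr rfl fun i hi => ?_
        rw [Finset.card_map]
        rcases hK i with ⟨W, hl⟩ | ⟨-, hc⟩
        · rw [hP, Finset.mem_filter, hl] at hi
          exact hi.2.elim
        · exact hc
      _ = P.card * K := by simp
  have hpos : 0 < P.card := Finset.card_pos.2 ⟨q, by simpa [hP] using hq⟩
  have hle : P.card ≤ n := by simpa using Finset.card_le_univ P
  rcases Nat.lt_or_ge 1 P.card with h1 | h1
  · have hg := hM P.card h1 hle
    rw [Nat.gcd_eq_left ⟨K, hcard⟩] at hg
    omega
  · rw [hcard, show P.card = 1 by omega, one_mul]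

/-- In a fair run some process enters the critical section if a process is trying to. -/
lemma exists_critical (h : RaceRun f σ mem phase loc)
    (hfair : ∀ i t, phase t i ≠ .remainder → ∃ t' ≥ t, σ t' = some i) (hM : m ∈ M n) {T : ℕ}
    {i : Fin n} (hi : phase T i = .trying) : ∃ t ≥ T, ∃ j, phase t j = .critical := by
  by_contra hnc
  push Not at hnc
  have htry : ∀ t ≥ T, phase t i = .trying := by
    intro t ht
    induction t, ht using Nat.le_induction with
    | base => exact hi
    | succ t ht ih =>
      by_cases hs : σ t = some i
      · obtain ⟨w, hmove, -⟩ := h.move hs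
        have hn := hnc (t + 1) (by omega) i
        rw [ih] at hmove
        generalize phase (t + 1) i = p' at hmove hn
        generalize loc t i = l at hmove
        generalize loc (t + 1) i = l' at hmove
        cases hmove <;> simp_all
      · rwa [(h.unchanged hs).1]
  -- `K` is the largest number of registers that contending processes own at arbitrarily late times.
  obtain ⟨K, hKsup, hKinf⟩ : ∃ K,
      (∃ T₁ ≥ T, ∀ t ≥ T₁, ∀ i, (loc t i).Contending → (loc t i).owned.card ≤ K) ∧
      (0 < K → ∀ T₁ ≥ T, ∃ t ≥ T₁, ∃ i, (loc t i).Contending ∧ K ≤ (loc t i).owned.card) := by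
    classical
    have hex : ∃ K, ∃ T₁ ≥ T, ∀ t ≥ T₁, ∀ i, (loc t i).Contending → (loc t i).owned.card ≤ K :=
      ⟨m, T, le_rfl, fun t _ i _ => by simpa using Finset.card_le_univ (loc t i).owned⟩
    refine ⟨Nat.find hex, Nat.find_spec hex, fun hpos T₁ hT₁ => ?_⟩
    have := Nat.find_min hex (Nat.sub_lt hpos one_pos)
    push Not at this
    obtain ⟨t, ht, j, hc, hlt⟩ := this T₁ hT₁
    exact ⟨t, ht, j, hc, by omega⟩
  obtain ⟨T₁, hT₁, hcard⟩ := hKsup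
  obtain ⟨T₂, hT₂, hmem⟩ := h.eventually_mem_le hfair (fun t ht => hnc t (hT₁.trans ht)) hcard
  have hb : Bounded mem phase loc T₂ K := ⟨fun t ht => hnc t (by omega),
    fun t ht => hcard t (by omega), hmem⟩
  have hKpos := h.bound_pos hfair hb fun t ht => htry t (by omega)
  obtain ⟨T₃, hT₃, q, hqc, hqK⟩ := hKinf hKpos T₂ (by omega)
  replace hqK := le_antisymm (hb.card_le T₃ hT₃ q hqc) hqK
  have hlead := h.leader_forever hb hT₃ hqc hqK
  have hb₃ : Bounded mem phase loc T₃ K := ⟨fun t ht => hb.not_critical t (by omega),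
    fun t ht => hb.card_le t (by omega), fun t ht => hb.mem_le t (by omega)⟩
  -- The register `f q x` captured last by the leader `q` holds the tag `K` forever.
  obtain ⟨x, hx, hxK⟩ := (h.inv T₃).exists_tag q hqc (Finset.card_pos.1 (by omega))
  have hy : ∀ t ≥ T₃, mem t (f q x) = K := by
    intro t ht
    induction t, ht using Nat.le_induction with
    | base => rw [hxK, hqK]
    | succ t ht ih =>
      rw [h.mem_eq_of_owned (by rw [(hlead t ht).2]; exact hx)
        (by rw [(hlead (t + 1) (by omega)).2]; exact hx), ih]
  choose T' hT' hG using fun i => h.eventually_wait_or_leader hfair hb₃ hKpos hy i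
  set T₄ := T₃ + ∑ i, T' i with hT₄
  have hG₄ : ∀ t ≥ T₄, ∀ i, (∃ W, loc t i = .wait W) ∨
      (loc t i).Contending ∧ (loc t i).owned.card = K := by
    intro t ht i
    have : T' i ≤ ∑ i, T' i := Finset.single_le_sum (fun _ _ => Nat.zero_le _) (Finset.mem_univ i)
    exact hG i t (by omega)
  have hkeep : ∀ y, ∃ s, ∀ t ≥ s, mem t y ≠ 0 := by
    intro y
    obtain ⟨s, hs, h0⟩ := h.exists_ne_zero_of_leader hfair hb (T' := T₄) (by omega)
      (hlead T₄ (by omega)).1 (by rw [(hlead T₄ (by omega)).2, hqK]) y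
    refine ⟨s, fun t ht => ?_⟩
    induction t, ht using Nat.le_induction with
    | base => exact h0
    | succ t ht ih =>
      obtain ⟨j, z, hz, rfl⟩ := ((h.inv t).ne_zero_iff y).1 ih
      rcases hG₄ t (by omega) j with ⟨W, hl⟩ | ⟨hc, hj⟩
      · simp [hl, Loc.owned] at hz
      · refine h.ne_zero_of_owned ?_
        rw [(h.leader_succ hb (by omega) hc hj).2]
        exact hz
  choose s hs using hkeep
  set T₅ := T₄ + ∑ y, s y with hT₅
  have hall : ∀ y, mem T₅ y ≠ 0 := by
    intro y
    have : s y ≤ ∑ y, s y := Finset.single_le_sum (fun _ _ => Nat.zero_le _) (Finset.mem_univ y)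
    exact hs y T₅ (by omega)
  have hKm := h.eq_of_all_owned hM q (hlead T₅ (by omega)).1 hall (hG₄ T₅ (by omega))
  -- The leader owns all the registers, but has not entered the critical section.
  obtain ⟨t, ht, -, S, Q, hl, hS, -, -⟩ := h.exists_visit hfair (fun t ht => (hlead t ht).1) 0
  refine hS ((Finset.card_eq_iff_eq_univ S).1 ?_)
  have := (hlead t ht).2
  rw [hl, Loc.owned] at this
  rw [this, hqK, hKm, Fintype.card_fin]

end RaceRun

theorem race_deadlockFree {m n : ℕ} [NeZero m] (hM : m ∈ M n) : (race m).DeadlockFree n := by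
  intro f σ hfair t ⟨i, hi⟩ hnc
  obtain ⟨t', ht', j, hj⟩ := (raceRun_run f σ).exists_critical hfair hM hi
  refine ⟨t', lt_of_le_of_ne ht' ?_, j, hj⟩
  rintro rfl
  exact hnc j hj

theorem race_releaseTerminates (m n : ℕ) [NeZero m] : (race m).ReleaseTerminates n := by
  intro f σ hfair t i hi
  obtain ⟨S, hS⟩ := ((raceRun_run f σ).inv t).releasing i hi
  obtain ⟨t', ht', -, hp⟩ := (raceRun_run f σ).exists_drop_end hfair (Or.inr hi) hS
  exact ⟨t', ht', hp hi⟩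

end FullyAnonymous

theorem mainTheorem1 (n m : ℕ) (hn : 2 ≤ n) (hm : 1 ≤ m) :
    ((∃ A : FullyAnonymous.Algorithm m, A.MutualExclusion n ∧ A.DeadlockFree n) ↔
      m ∈ FullyAnonymous.M n) ∧
    ((∃ A : FullyAnonymous.Algorithm m,
        A.MutualExclusion n ∧ A.DeadlockFree n ∧ A.ReleaseTerminates n) ↔
      m ∈ FullyAnonymous.M n) := by
  have : NeZero m := ⟨by omega⟩
  refine ⟨⟨fun ⟨A, hmx, hdf⟩ => FullyAnonymous.mem_M_of_algorithm hm A hmx hdf,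
    fun hM => ⟨FullyAnonymous.race m, FullyAnonymous.race_mutualExclusion m n,
      FullyAnonymous.race_deadlockFree hM⟩⟩,
    ⟨fun ⟨A, hmx, hdf, _⟩ => FullyAnonymous.mem_M_of_algorithm hm A hmx hdf,
    fun hM => ⟨FullyAnonymous.race m, FullyAnonymous.race_mutualExclusion m n,
      FullyAnonymous.race_deadlockFree hM, FullyAnonymous.race_releaseTerminates m n⟩⟩⟩
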